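/- Let $d$ be a natural number, let $F\subseteq\mathbb{Z}^d$ be a finite set of $k=|F|\ge 3$ points, let $r\ge 1$ be an integer (the number of colours), and let $\mu\in\left(0,\frac{k-1}{k}\right)$ be real. A homothetic copy of $F$ is a set of the form $v+\lambda F=\{v+\lambda f\colon f\in F\}$, where $v\in\mathbb{Z}^d$ and $\lambda$ is a positive integer. A set $Z\subseteq\mathbb{Z}^d$ is called $F$-free if there is no nonzero real number $\lambda$ such that $Z$ contains a congruent copy of $\lambda F$ (congruence being with respect to the Euclidean distance on $\mathbb{R}^d$). Write $\mathbb{N}=\{1,2,3,\dots\}$. Then there exists a finite set $X\subseteq\mathbb{N}^d$ such that (i) for every $r$-colouring of $X$ there is a monochromatic homothetic copy of $F$ contained in $X$, and (ii) every $Y\subseteq X$ has an $F$-free subset $Z\subseteq Y$ of size $|Z|\ge\mu|Y|$. -/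

import Mathlib

/-- The lattice point `x ∈ ℤ^d`, regarded as a point of Euclidean space `ℝ^d`. -/
noncomputable def latticePoint {d : ℕ} (x : Fin d → ℤ) : EuclideanSpace ℝ (Fin d) :=
  WithLp.toLp 2 (fun i => (x i : ℝ))

/-- `Z` contains a congruent copy of `t F`: there is a way of assigning to the points `f` of `F`
points `g f` of `Z` such that the configurations `(t f)` and `(g f)` are congruent in `ℝ^d`
(all distances agree, so reflections are allowed). -/
def ContainsCongruentCopy {d : ℕ} (F Z : Finset (Fin d → ℤ)) (t : ℝ) : Prop :=
  ∃ g : F → Fin d → ℤ, (∀ f, g f ∈ Z) ∧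
    Congruent (fun f : F => t • latticePoint (f : Fin d → ℤ)) (fun f : F => latticePoint (g f))

/-- `Z` is `F`-free: for no nonzero real `t` does `Z` contain a congruent copy of `t F`. -/
def IsFreeOf {d : ℕ} (F Z : Finset (Fin d → ℤ)) : Prop :=
  ¬ ∃ t : ℝ, t ≠ 0 ∧ ContainsCongruentCopy F Z t

/-- Under the colouring `c` of `X` by `r` colours, `X` contains a monochromatic homothetic copy
`v + m F` of `F`, where `v ∈ ℤ^d` and `m` is a positive integer. -/
def HasMonochromaticHomotheticCopy {d r : ℕ} (F X : Finset (Fin d → ℤ)) (c : X → Fin r) : Prop :=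
  ∃ (v : Fin d → ℤ) (m : ℤ), 0 < m ∧ ∃ j : Fin r,
    ∀ f ∈ F, ∃ h : v + m • f ∈ X, c ⟨v + m • f, h⟩ = j

/-! Words over the alphabet F become lattice points through a combination of their letters with
generic positive coefficients. Combinatorial lines then become homothetic copies of F, while a
congruent copy of t F with t ≠ 0 can only come from a quasi-line (`exists_generic_combination`). So
a sparse but Ramsey set of words is needed. A partite construction labels words by vertices of a
k-uniform linear hypergraph: labelled quasi-lines lie over edges, yet every colouring of the words
depends only on the label along suitable lines, one over each edge (`exists_picture`). Vertices are
treated one at a time, by a Hales–Jewett theorem with union-free wildcard sets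
(`exists_unionFree_halesJewett`); union-freeness is what excludes unwanted quasi-lines
(`label_mem_edges`).

The hypergraph must have a monochromatic edge in each r-colouring, but also random hitting sets that
miss each vertex with probability at least μ. An edge consists of the k sequences obtained from an
increasing sequence by deleting one of k equally spaced terms. Ramsey's theorem gives the first
property (`exists_monochromatic_deletions`), random marks and a random residue modulo k the second
(`exists_hitting_family`). Averaging over the hitting sets extracts from Y a large Z whose labels
contain no edge. -/

/-! ### Hales–Jewett with union-free wildcard sets -/

/-- A family of sets without the empty set in which no member is the union of two disjoint
members. -/
def UnionFree {ι : Type*} (𝒲 : Set (Set ι)) : Prop :=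
  ∅ ∉ 𝒲 ∧ ∀ W₀ ∈ 𝒲, ∀ W₁ ∈ 𝒲, Disjoint W₀ W₁ → W₀ ∪ W₁ ∉ 𝒲

/-- The Hales–Jewett property for lines `L : ι → Option A` (where `none` marks the wildcards)
whose set of wildcards belongs to `𝒲`. -/
def HalesJewettFor {ι : Type*} (A κ : Type*) (𝒲 : Set (Set ι)) : Prop :=
  ∀ c : (ι → A) → κ, ∃ L : ι → Option A, {i | L i = none} ∈ 𝒲 ∧
    ∀ a b, c (fun i => (L i).getD a) = c (fun i => (L i).getD b)

/-- Shift graphs have unbounded chromatic number: if x < y see the same set of colours to their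
right, the colour of (x, y) occurs again on some pair (y, l). -/
theorem exists_shift_monochromatic (κ : Type) [Finite κ] :
    ∃ M : ℕ, ∀ c : ℕ → ℕ → κ, ∃ i j l, i < j ∧ j < l ∧ l < M ∧ c i j = c j l := by
  classical
  have := Fintype.ofFinite κ
  refine ⟨Fintype.card (Set κ) + 1, fun c => ?_⟩
  set M := Fintype.card (Set κ) + 1
  obtain ⟨x, y, hxy, h⟩ := Fintype.exists_ne_map_eq_of_card_lt
    (fun j : Fin M => {p : κ | ∃ l, j.1 < l ∧ l < M ∧ c j l = p}) (by simp [M])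
  wlog hlt : x < y generalizing x y
  · exact this y x hxy.symm h.symm (lt_of_le_of_ne (not_lt.mp hlt) hxy.symm)
  have hmem : c x y ∈ {p : κ | ∃ l, x.1 < l ∧ l < M ∧ c x l = p} := ⟨y, hlt, y.2, rfl⟩
  rw [h] at hmem
  obtain ⟨l, h1, h2, h3⟩ := hmem
  exact ⟨x, y, l, hlt, h1, h2, h3.symm⟩

/-- The pair (i, j) is coded by j * M + i, so colours of initial segments colour pairs, and 𝒟
consists of the intervals from (i, j) to (j, l). Adjacent intervals run from (i, j) over (j, l) to
(l, l'); their union lies in 𝒟 only if j = l. -/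
theorem exists_unionFree_two_letters (κ : Type) [Finite κ] :
    ∃ (T : Type) (_ : Finite T) (𝒟 : Set (Set T)), UnionFree 𝒟 ∧
      ∀ c : Set T → κ, ∃ D ∈ 𝒟, ∃ S, Disjoint S D ∧ c S = c (S ∪ D) := by
  obtain ⟨M, hM⟩ := exists_shift_monochromatic κ
  have key : ∀ {i j l : ℕ}, i < j → j < l → l < M → j * M + i < l * M + j ∧ l * M + j < M * M := by
    intro i j l h1 h2 h3
    constructor <;> nlinarith
  have inj : ∀ {i j i' j' : ℕ}, i < M → i' < M → j * M + i = j' * M + i' → i = i' ∧ j = j' := by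
    intro i j i' j' h1 h2 h
    have hi : i = i' := by
      have := congrArg (· % M) h
      simpa [Nat.mul_add_mod', Nat.mod_eq_of_lt h1, Nat.mod_eq_of_lt h2] using this
    subst hi
    exact ⟨rfl, Nat.eq_of_mul_eq_mul_right (by omega : 0 < M) (by omega)⟩
  refine ⟨Fin (M * M), inferInstance, {D | ∃ i j l, i < j ∧ j < l ∧ l < M ∧
    D = {t | j * M + i ≤ t.1 ∧ t.1 < l * M + j}}, ⟨?_, ?_⟩, ?_⟩
  · rintro ⟨i, j, l, h1, h2, h3, h⟩
    obtain ⟨h4, h5⟩ := key h1 h2 h3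
    have : (⟨j * M + i, h4.trans h5⟩ : Fin (M * M)) ∈ (∅ : Set (Fin (M * M))) := by
      rw [h]; exact ⟨le_rfl, h4⟩
    exact this
  · rintro _ ⟨i, j, l, h1, h2, h3, rfl⟩ _ ⟨i', j', l', h1', h2', h3', rfl⟩ hd
      ⟨i'', j'', l'', h1'', h2'', h3'', h⟩
    have k1 := key h1 h2 h3
    have k2 := key h1' h2' h3'
    have k3 := key h1'' h2'' h3''
    have hd' : ∀ t, t < M * M → ¬ ((j * M + i ≤ t ∧ t < l * M + j) ∧
        (j' * M + i' ≤ t ∧ t < l' * M + j')) := fun t ht hh =>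
      Set.disjoint_left.mp hd (show (⟨t, ht⟩ : Fin (M * M)) ∈ _ from hh.1) hh.2
    have h' : ∀ t, t < M * M → (((j * M + i ≤ t ∧ t < l * M + j) ∨
        (j' * M + i' ≤ t ∧ t < l' * M + j')) ↔ (j'' * M + i'' ≤ t ∧ t < l'' * M + j'')) :=
      fun t ht => Set.ext_iff.mp h ⟨t, ht⟩
    generalize hp : j * M + i = p at *
    generalize hq : l * M + j = q at *
    generalize hp' : j' * M + i' = p' at *
    generalize hq' : l' * M + j' = q' at *
    generalize hp'' : j'' * M + i'' = p'' at *
    generalize hq'' : l'' * M + j'' = q'' at *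
    have a1 := h' p (by omega)
    have a2 := h' p' (by omega)
    have a3 := h' p'' (by omega)
    have b1 := h' (q - 1) (by omega)
    have b2 := h' (q' - 1) (by omega)
    have b3 := h' (q'' - 1) (by omega)
    have d1 := hd' p (by omega)
    have d2 := hd' p' (by omega)
    have : (p = p'' ∧ q = p' ∧ q' = q'') ∨ (p' = p'' ∧ q' = p ∧ q = q'') := by
      rcases lt_trichotomy p p' with hlt | heq | hlt
      · left
        have : q ≤ p' := by omega
        have e1 : p = p'' := by omega
        have e2 : q' = q'' := by omega
        have b4 := h' q (by omega)
        omega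
      · omega
      · right
        have : q' ≤ p := by omega
        have e1 : p' = p'' := by omega
        have e2 : q = q'' := by omega
        have b4 := h' q' (by omega)
        omega
    rcases this with ⟨e1, e2, e3⟩ | ⟨e1, e2, e3⟩
    · subst e1 e2 e3
      have g1 := inj (by omega) (by omega) (hp.trans hp''.symm)
      have g2 := inj (by omega) (by omega) (hq.trans hp'.symm)
      have g3 := inj (by omega) (by omega) (hq'.trans hq''.symm)
      omega
    · subst e1 e2 e3
      have g1 := inj (by omega) (by omega) (hp'.trans hp''.symm)
      have g2 := inj (by omega) (by omega) (hq'.trans hp.symm)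
      have g3 := inj (by omega) (by omega) (hq.trans hq''.symm)
      omega
  · intro c
    obtain ⟨i, j, l, h1, h2, h3, h⟩ := hM (fun i j => c {t | t.1 < j * M + i})
    refine ⟨_, ⟨i, j, l, h1, h2, h3, rfl⟩, {t | t.1 < j * M + i}, ?_, ?_⟩
    · rw [Set.disjoint_left]
      intro t ht ht'
      exact absurd ht (not_lt.mpr ht'.1)
    · rw [h]
      congr 1
      ext t
      have := (key h1 h2 h3).1
      simp only [Set.mem_ofPred_eq, Set.mem_union]
      omega

/-- Blocks of coordinates indexed by `T`, in each of which there is a line over `A` such that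
the colour of a word over `Option A` depends only on the blocks which receive `none`. -/
theorem exists_insensitive_blocks (A : Type) [Finite A]
    (hA : ∀ (κ : Type) [Finite κ], ∃ (ι : Type) (_ : Finite ι) (𝒲 : Set (Set ι)),
      UnionFree 𝒲 ∧ HalesJewettFor A κ 𝒲) (T : Type) [Finite T] :
    ∀ (κ : Type) [Finite κ], ∃ (ι : Type) (_ : Finite ι) (blk : ι → T) (𝒲 : T → Set (Set ι)),
      (∀ t, UnionFree (𝒲 t)) ∧ ∀ c : (ι → Option A) → κ, ∃ L : ι → Option A,
        (∀ t, {i | L i = none ∧ blk i = t} ∈ 𝒲 t) ∧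
        ∀ x y : T → Option A, (∀ t, x t = none ↔ y t = none) →
          c (fun i => (L i).elim (x (blk i)) some) = c (fun i => (L i).elim (y (blk i)) some) := by
  induction T using Finite.induction_empty_option with
  | of_equiv e ih =>
    intro κ _
    obtain ⟨ι, hι, blk, 𝒲, h1, h2⟩ := ih κ
    refine ⟨ι, hι, e ∘ blk, 𝒲 ∘ e.symm, fun t => h1 _, fun c => ?_⟩
    obtain ⟨L, h3, h4⟩ := h2 c
    refine ⟨L, fun t => ?_, fun x y hxy => h4 (x ∘ e) (y ∘ e) fun t => hxy _⟩
    simpa [Equiv.eq_symm_apply] using h3 (e.symm t)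
  | h_empty =>
    intro κ _
    exact ⟨Empty, inferInstance, Empty.elim, fun t => t.elim, fun t => t.elim, fun c =>
      ⟨Empty.elim, fun t => t.elim, fun x y _ => congrArg c (funext fun i => i.elim)⟩⟩
  | @h_option T' _ ih =>
    intro κ _
    -- The old blocks treat the colour as a function of the letter in the new block; the new block
    -- is then chosen to serve all words on the old ones at once.
    obtain ⟨ι', _, blk', 𝒲', h1, h2⟩ := ih (Option A → κ)
    obtain ⟨ι₀, _, 𝒲₀, h3, h4⟩ := hA ((ι' → Option A) → κ)
    refine ⟨ι' ⊕ ι₀, inferInstance, Sum.elim (some ∘ blk') (fun _ => none),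
      fun t => t.elim {W | ∃ W₀ ∈ 𝒲₀, W = Sum.inr '' W₀}
        (fun t => {W | ∃ W₀ ∈ 𝒲' t, W = Sum.inl '' W₀}), ?_, fun c => ?_⟩
    · have lift : ∀ {α β : Type} (g : α → β) (_ : g.Injective) (𝒰 : Set (Set α)),
          UnionFree 𝒰 → UnionFree {W | ∃ W₀ ∈ 𝒰, W = g '' W₀} := by
        intro α β g hg 𝒰 hU
        refine ⟨?_, ?_⟩
        · rintro ⟨W, hW, h⟩
          rw [eq_comm, Set.image_eq_empty] at h
          exact hU.1 (h ▸ hW)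
        · rintro _ ⟨W, hW, rfl⟩ _ ⟨W', hW', rfl⟩ hd ⟨W'', hW'', h⟩
          rw [← Set.image_union] at h
          rw [← hg.image_injective h] at hW''
          exact hU.2 W hW W' hW' ((Set.disjoint_image_iff hg).mp hd) hW''
      rintro (_ | t)
      · exact lift _ Sum.inr_injective _ h3
      · exact lift _ Sum.inl_injective _ (h1 t)
    · obtain ⟨L₀, hL₀, h5⟩ := h4 (fun w v => c (Sum.elim v (some ∘ w)))
      obtain ⟨L', hL', h6⟩ :=
        h2 (fun v a => c (Sum.elim v (fun i => (L₀ i).elim a some)))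
      refine ⟨Sum.elim L' L₀, ?_, fun x y hxy => ?_⟩
      · rintro (_ | t)
        · refine ⟨_, hL₀, ?_⟩
          ext (i | i) <;> simp
        · refine ⟨_, hL' t, ?_⟩
          ext (i | i) <;> simp
      · have split : ∀ z : Option T' → Option A,
            (fun i => (Sum.elim L' L₀ i).elim
              (z ((Sum.elim (some ∘ blk') (fun _ => none) : ι' ⊕ ι₀ → Option T') i)) some) =
            Sum.elim (fun i => (L' i).elim (z (some (blk' i))) some)
              (fun i => (L₀ i).elim (z none) some) := by
          intro z
          ext (i | i) <;> simp
        rw [split, split]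
        have s1 := congrFun (h6 (x ∘ some) (y ∘ some) fun t => hxy _) (x none)
        simp only [Function.comp] at s1
        rw [s1]
        rcases hx : x none with _ | a
        · rw [(hxy none).mp hx]
        · rcases hy : y none with _ | b
          · rw [(hxy none).mpr hy] at hx; cases hx
          · have s2 := congrFun (h5 a b) (fun i => (L' i).elim (y (some (blk' i))) some)
            have conv : ∀ a : A, (some ∘ fun i => (L₀ i).getD a) =
                fun i => (L₀ i).elim (some a) some := by
              intro a; ext i; cases h : L₀ i <;> simp [h]
            simpa only [conv] using s2

theorem unionFree_univ_unit : UnionFree {(Set.univ : Set Unit)} := by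
  refine ⟨fun h => ?_, fun W₀ h₀ W₁ h₁ hd => ?_⟩
  · exact Set.empty_ne_univ (Set.mem_singleton_iff.mp h)
  · rw [Set.mem_singleton_iff] at h₀ h₁
    subst h₀ h₁
    simp at hd

theorem halesJewettFor_unit (A κ : Type) [Subsingleton A] :
    HalesJewettFor A κ {(Set.univ : Set Unit)} := fun c =>
  ⟨fun _ => none, by simp, fun a b => by rw [Subsingleton.elim a b]⟩

/-- The Hales–Jewett theorem with a union-free family of wildcard sets. -/
theorem exists_unionFree_halesJewett (A : Type) [Finite A] :
    ∀ (κ : Type) [Finite κ], ∃ (ι : Type) (_ : Finite ι) (𝒲 : Set (Set ι)),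
      UnionFree 𝒲 ∧ HalesJewettFor A κ 𝒲 := by
  induction A using Finite.induction_empty_option with
  | of_equiv e ih =>
    intro κ _
    obtain ⟨ι, hι, 𝒲, h1, h2⟩ := ih κ
    refine ⟨ι, hι, 𝒲, h1, fun c => ?_⟩
    obtain ⟨L, h3, h4⟩ := h2 (fun w => c (e ∘ w))
    refine ⟨fun i => (L i).map e, by simpa using h3, fun a b => ?_⟩
    have conv : ∀ a, (fun i => ((L i).map e).getD a) = e ∘ fun i => (L i).getD (e.symm a) := by
      intro a; ext i; cases h : L i <;> simp [h]
    rw [conv, conv]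
    exact h4 _ _
  | h_empty =>
    intro κ _
    exact ⟨Unit, inferInstance, _, unionFree_univ_unit, halesJewettFor_unit _ _⟩
  | @h_option A _ ih =>
    intro κ _
    rcases isEmpty_or_nonempty A with hA | ⟨⟨a₀⟩⟩
    · exact ⟨Unit, inferInstance, _, unionFree_univ_unit, halesJewettFor_unit _ _⟩
    classical
    obtain ⟨T, _, 𝒟, hD, hT⟩ := exists_unionFree_two_letters κ
    obtain ⟨ι, hι, blk, 𝒲, hW, hc⟩ := exists_insensitive_blocks A ih T κ
    -- If disjoint W₀, W₁ have their union W₂ in this family, then D₂ = D₀ ∪ D₁. Disjoint D₀, D₁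
    -- contradict union-freeness of 𝒟; a common block t contradicts that of 𝒲 t.
    refine ⟨ι, hι, {W | ∃ D ∈ 𝒟, (∀ i ∈ W, blk i ∈ D) ∧ ∀ t ∈ D, {i | i ∈ W ∧ blk i = t} ∈ 𝒲 t},
      ⟨?_, ?_⟩, fun c => ?_⟩
    · rintro ⟨D, hD', -, h⟩
      have : D = ∅ := by
        rw [Set.eq_empty_iff_forall_notMem]
        intro t ht
        apply (hW t).1
        simpa using h t ht
      exact hD.1 (this ▸ hD')
    · rintro W₀ ⟨D₀, hD₀, a₁, b₁⟩ W₁ ⟨D₁, hD₁, a₂, b₂⟩ hd ⟨D₂, hD₂, a₃, b₃⟩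
      have ex : ∀ {t} {W : Set ι}, {i | i ∈ W ∧ blk i = t} ∈ 𝒲 t → ∃ i ∈ W, blk i = t := by
        intro t W h
        by_contra! hne
        apply (hW t).1
        convert h
        rw [eq_comm, Set.eq_empty_iff_forall_notMem]
        exact fun i hi => hne i hi.1 hi.2
      have hU : D₂ = D₀ ∪ D₁ := by
        ext t
        constructor
        · intro ht
          obtain ⟨i, hi, rfl⟩ := ex (b₃ t ht)
          exact hi.imp (a₁ i) (a₂ i)
        · rintro (ht | ht)
          · obtain ⟨i, hi, rfl⟩ := ex (b₁ t ht)
            exact a₃ i (Or.inl hi)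
          · obtain ⟨i, hi, rfl⟩ := ex (b₂ t ht)
            exact a₃ i (Or.inr hi)
      by_cases hdis : Disjoint D₀ D₁
      · exact hD.2 D₀ hD₀ D₁ hD₁ hdis (hU ▸ hD₂)
      · obtain ⟨t, ht₀, ht₁⟩ := Set.not_disjoint_iff.mp hdis
        refine (hW t).2 _ (b₁ t ht₀) _ (b₂ t ht₁) ?_ ?_
        · rw [Set.disjoint_left] at hd ⊢
          exact fun i hi hi' => hd hi.1 hi'.1
        · have := b₃ t (hU ▸ Or.inl ht₀)
          convert this using 1
          ext i
          simp only [Set.mem_union, Set.mem_ofPred_eq]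
          tauto
    · obtain ⟨L, hL, hins⟩ := hc c
      obtain ⟨D, hD', S, hSD, hcol⟩ := hT (fun S => c (fun i =>
        (L i).elim (if blk i ∈ S then none else some a₀) some))
      -- Here `some none` is the new letter. Filling in a letter of A leaves the new letter on the
      -- blocks of S, filling in the new letter puts it on those of S ∪ D.
      refine ⟨fun i => (L i).elim (if blk i ∈ D then none else
        some (if blk i ∈ S then none else some a₀)) (fun a => some (some a)), ?_, ?_⟩
      · refine ⟨D, hD', ?_, fun t ht => ?_⟩
        · intro i hi
          by_contra hn
          cases h : L i <;> simp [h, hn] at hi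
        · convert hL t using 1
          ext i
          simp only [Set.mem_ofPred_eq]
          constructor
          · rintro ⟨h, rfl⟩
            cases h' : L i <;> simp [h'] at h ⊢
          · rintro ⟨h, rfl⟩
            simp [h, ht]
      · have conv : ∀ a : Option A, (fun i => ((L i).elim (if blk i ∈ D then none else
            some (if blk i ∈ S then none else some a₀)) (fun a => some (some a))).getD a) =
            fun i => (L i).elim ((fun t => if t ∈ D then a else if t ∈ S then none else some a₀)
              (blk i)) some := by
          intro a; ext1 i
          cases h : L i
          · by_cases h' : blk i ∈ D <;> simp [h']
          · simp
        have col : ∀ a : Option A, c (fun i => (L i).elim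
            ((fun t => if t ∈ D then a else if t ∈ S then none else some a₀) (blk i)) some) =
            c (fun i => (L i).elim (if blk i ∈ S then none else some a₀) some) := by
          rintro (_ | a)
          · rw [hcol]
            convert hins (fun t => if t ∈ D then none else if t ∈ S then none else some a₀)
              (fun t => if t ∈ S ∪ D then none else some a₀) ?_ using 1
            · congr!
            · intro t
              by_cases h1 : t ∈ D <;> by_cases h2 : t ∈ S <;> simp [h1, h2]
          · refine hins (fun t => if t ∈ D then some a else if t ∈ S then none else some a₀)
              (fun t => if t ∈ S then none else some a₀) fun t => ?_
            have : t ∈ S → t ∉ D := fun h => Set.disjoint_left.mp hSD h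
            by_cases h1 : t ∈ D <;> by_cases h2 : t ∈ S <;> simp_all
        intro a b
        rw [conv, conv, col, col]

/-! ### Pictures over a linear system -/

/-- Every coordinate of `g` is constant or injective, and some coordinate is injective. -/
def IsQuasiLine {K κ : Type*} (g : K → κ → K) : Prop :=
  (∃ x, Function.Injective fun f => g f x) ∧
    ∀ x, (Function.Injective fun f => g f x) ∨ ∀ f f', g f x = g f' x

/-- The point with parameter `f` on the line `L`. -/
def linePoint {K κ : Type*} (L : κ → Option K) (f : K) : κ → K := fun x => (L x).getD f

/-- A system of `K`-tuples (with injective members) any two of which share at most one vertex. -/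
structure IsLinearSystem {K V E : Type*} (e : E → K → V) : Prop where
  injective : ∀ a, Function.Injective (e a)
  linear : ∀ a b f f' g g', f ≠ f' → e a f = e b g → e a f' = e b g' → a = b

/-- Words over `K`, some of which are labelled by vertices, such that every labelled quasi-line
lies over an edge, and such that every colouring is, on a suitable system of lines over all
edges, determined on the labels in `S` by the label. -/
structure IsPicture {K V E κ : Type*} (e : E → K → V) (C : Type*) (S : Set V)
    (Lab : (κ → K) → V → Prop) : Prop where
  functional : ∀ w u u', Lab w u → Lab w u' → u = u'
  faithful : ∀ g : K → κ → K, IsQuasiLine g → ∀ u : K → V, (∀ f, Lab (g f) (u f)) →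
    ∃ a, ∃ σ : K → K, Function.Injective σ ∧ ∀ f, u f = e a (σ f)
  ramsey : ∀ c : (κ → K) → C, ∃ χ : V → C, ∀ a, ∃ L : κ → Option K, (∃ x, L x = none) ∧
    (∀ f, Lab (linePoint L f) (e a f)) ∧ ∀ f, e a f ∈ S → c (linePoint L f) = χ (e a f)

section Base

variable {K V E : Type}

/-- The `f`-th point of the `a`-th one of a family of disjoint lines. -/
noncomputable def disjointLine (k₀ k₁ : K) (a : E) : E ⊕ E → Option K := by
  classical
  exact Sum.elim (fun b => if b = a then none else some k₀)
    (fun b => if b = a then some k₁ else some k₀)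

/-- One line per edge, with the second copy of E tagging the edge. Tags take two values and K has at
least three elements, so quasi-lines are constant there and stay on one line. -/
theorem exists_base_picture [Fintype K] (hK : 3 ≤ Fintype.card K) [Finite E]
    (e : E → K → V) (C : Type) [Nonempty C] :
    ∃ (κ : Type) (_ : Finite κ) (Lab : (κ → K) → V → Prop),
      IsPicture e C ∅ Lab := by
  classical
  obtain ⟨k₀, k₁, hk⟩ := Fintype.exists_pair_of_one_lt_card (by omega : 1 < Fintype.card K)
  have hl : ∀ a f b, linePoint (disjointLine k₀ k₁ a) f (Sum.inl b : E ⊕ E) =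
      if b = a then f else k₀ := by
    intro a f b
    by_cases h : b = a <;> simp [linePoint, disjointLine, h]
  have hr : ∀ a f b, linePoint (disjointLine k₀ k₁ a) f (Sum.inr b : E ⊕ E) =
      if b = a then k₁ else k₀ := by
    intro a f b
    by_cases h : b = a <;> simp [linePoint, disjointLine, h]
  have hinj : ∀ {a f a' f'}, linePoint (disjointLine k₀ k₁ (a : E)) f =
      linePoint (disjointLine k₀ k₁ a') f' → a = a' ∧ f = f' := by
    intro a f a' f' h
    have h1 := congrFun h (Sum.inr a)
    rw [hr, hr, if_pos rfl] at h1
    have ha : a = a' := by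
      by_contra hne
      rw [if_neg hne] at h1
      exact hk h1.symm
    subst ha
    have h2 := congrFun h (Sum.inl a)
    rw [hl, hl, if_pos rfl, if_pos rfl] at h2
    exact ⟨rfl, h2⟩
  refine ⟨E ⊕ E, inferInstance,
    fun w u => ∃ a f, w = linePoint (disjointLine k₀ k₁ a) f ∧ u = e a f, ⟨?_, ?_, ?_⟩⟩
  · rintro w u u' ⟨a, f, rfl, rfl⟩ ⟨a', f', h, rfl⟩
    obtain ⟨rfl, rfl⟩ := hinj h
    rfl
  · intro g hg u hu
    choose a σ hw hu using hu
    obtain ⟨⟨x, hx⟩, hall⟩ := hg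
    have hconst : ∀ f f', a f = a f' := by
      intro f f'
      have hnot : ¬ Function.Injective fun j => g j (Sum.inr (a f)) := by
        intro hin
        have hcard := Finset.card_le_card_of_injOn (s := Finset.univ) (t := {k₁, k₀})
          (fun j => g j (Sum.inr (a f))) (fun j _ => by
            simp only [hw j, hr]
            split_ifs <;> simp) hin.injOn
        have := Finset.card_le_two (a := k₁) (b := k₀)
        rw [Finset.card_univ] at hcard
        omega
      have h1 := (hall (Sum.inr (a f))).resolve_left hnot f f'
      rw [hw f, hw f', hr, hr, if_pos rfl] at h1
      by_contra hne
      rw [if_neg hne] at h1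
      exact hk h1.symm
    refine ⟨a k₀, σ, fun f f' hff => hx ?_, fun f => by rw [hu f, hconst f k₀]⟩
    show g f x = g f' x
    rw [hw f, hw f', hff, hconst f f']
  · intro c
    exact ⟨fun _ => Classical.arbitrary C, fun a => ⟨disjointLine k₀ k₁ a,
      ⟨Sum.inl a, by simp [disjointLine]⟩, fun f => ⟨a, f, rfl, rfl⟩, fun f hf => hf.elim⟩⟩

end Base

/-! ### Amalgamation along one vertex -/

section Amalgamation

variable {K V E κ ι : Type}

/-- Labelled words over the labelled words of `Lab`: either all letters have the label `v`, or
the letters without the label `v` are all equal and occupy a set of positions in `𝒲`. -/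
def amalgam (Lab : (κ → K) → V → Prop) (v : V) (𝒲 : Set (Set ι)) (w : ι × κ → K) (u : V) : Prop :=
  (u = v ∧ ∀ i, Lab (fun x => w (i, x)) v) ∨
    (u ≠ v ∧ ∃ p, Lab p u ∧ ∃ W ∈ 𝒲, (∀ i ∈ W, (fun x => w (i, x)) = p) ∧
      ∀ i ∉ W, Lab (fun x => w (i, x)) v)

/-- If `y i f` is the label of the letter in position `i` of the word with index `f`, and `u f` is
the label of that word, then the labels of the words form an edge. -/
theorem label_mem_edges [Fintype K] (hK : 3 ≤ Fintype.card K) {e : E → K → V}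
    (he : IsLinearSystem e) (v : V) {𝒲 : Set (Set ι)} (h𝒲 : UnionFree 𝒲) (y : ι → K → V)
    (u : K → V) (hu : ∀ i f, y i f ≠ v → y i f = u f) (hW : ∀ f, u f ≠ v → {i | y i f ≠ v} ∈ 𝒲)
    (hy : ∀ i, (∀ f f', y i f = y i f') ∨
      ∃ a, ∃ σ : K → K, Function.Injective σ ∧ ∀ f, y i f = e a (σ f))
    (hne : ∃ i a, ∃ σ : K → K, Function.Injective σ ∧ ∀ f, y i f = e a (σ f)) :
    ∃ a, ∃ σ : K → K, Function.Injective σ ∧ ∀ f, u f = e a (σ f) := by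
  classical
  obtain ⟨i₀, a, σ, hσ, hi₀⟩ := hne
  have third : ∀ f g : K, ∃ h, h ≠ f ∧ h ≠ g := by
    intro f g
    obtain ⟨h, hh⟩ : ∃ h, h ∉ ({f, g} : Finset K) := by
      by_contra! hall
      have h1 := Finset.card_le_card (fun x _ => hall x : Finset.univ ⊆ ({f, g} : Finset K))
      have h2 := Finset.card_le_two (a := f) (b := g)
      rw [Finset.card_univ] at h1
      omega
    exact ⟨h, by simpa [not_or] using hh⟩
  have hinj : ∀ {i a} {τ : K → K}, Function.Injective τ → (∀ f, y i f = e a (τ f)) →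
      ∀ {f f'}, y i f = y i f' → f = f' := by
    intro i a τ hτ h f f' hff
    rw [h, h] at hff
    exact hτ (he.injective a hff)
  by_cases hall : ∀ f, y i₀ f ≠ v
  · exact ⟨a, σ, hσ, fun f => by rw [← hu i₀ f (hall f), hi₀]⟩
  push Not at hall
  obtain ⟨f₀, hf₀⟩ := hall
  have hne₀ : ∀ f, f ≠ f₀ → y i₀ f ≠ v := fun f hf h => hf (hinj hσ hi₀ (h.trans hf₀.symm))
  have hua : ∀ f, f ≠ f₀ → u f = e a (σ f) := fun f hf => by rw [← hu i₀ f (hne₀ f hf), hi₀]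
  have huv : ∀ f, f ≠ f₀ → u f ≠ v := fun f hf => hu i₀ f (hne₀ f hf) ▸ hne₀ f hf
  have huinj : ∀ f f', f ≠ f₀ → f' ≠ f₀ → u f = u f' → f = f' := by
    intro f f' hf hf' h
    rw [hua f hf, hua f' hf'] at h
    exact hσ (he.injective a h)
  by_cases hv : u f₀ = v
  · refine ⟨a, σ, hσ, fun f => ?_⟩
    by_cases hf : f = f₀
    · rw [hf, hv, ← hf₀, hi₀]
    · exact hua f hf
  -- Now u follows the edge a except at f₀, where a has v but u does not. Any position j with y j f₀
  -- ≠ v carries an edge sharing two vertices with a, hence a itself; so it has v at the index f₁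
  -- with u f₁ = u f₀.
  exfalso
  have hsurj := Finite.surjective_of_injective hσ
  have key : ∀ j, y j f₀ ≠ v → ∃ f₁, f₁ ≠ f₀ ∧ y j f₁ = v ∧ u f₁ = u f₀ ∧
      ∀ f₂, f₂ ≠ f₁ → y j f₂ ≠ v := by
    intro j hj
    rcases hy j with hc | ⟨b, τ, hτ, hb⟩
    · exfalso
      obtain ⟨f, hf, -⟩ := third f₀ f₀
      obtain ⟨f', hf', hff⟩ := third f₀ f
      have h1 : ∀ f, u f = y j f₀ := fun f => by
        rw [← hc f f₀, hu j f (by rw [hc f f₀]; exact hj)]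
      exact hff (huinj f' f hf' hf (by rw [h1, h1]))
    by_cases hex : ∃ f₁, y j f₁ = v
    · obtain ⟨f₁, hf₁⟩ := hex
      have h10 : f₁ ≠ f₀ := fun h => hj (h ▸ hf₁)
      have hnv : ∀ f₂, f₂ ≠ f₁ → y j f₂ ≠ v := fun f₂ h2 h =>
        h2 (hinj hτ hb (h.trans hf₁.symm))
      refine ⟨f₁, h10, hf₁, ?_, hnv⟩
      have h1 : e b (τ f₁) = e a (σ f₀) := by rw [← hb, ← hi₀, hf₁, hf₀]
      have h2 : ∀ f, f ≠ f₀ → f ≠ f₁ → e b (τ f) = e a (σ f) := fun f h h' => by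
        rw [← hb, hu j f (hnv f h'), hua f h]
      obtain ⟨f₂, h20, h21⟩ := third f₀ f₁
      obtain rfl : b = a := he.linear b a _ _ _ _ (hτ.ne h21) (h2 f₂ h20 h21) h1
      obtain ⟨g, hg⟩ := hsurj (τ f₀)
      have hg0 : g ≠ f₀ := by
        rintro rfl
        rw [hg] at h1
        exact h10 (hτ (he.injective _ h1))
      have hg1 : g = f₁ := by
        by_contra hg1
        have h3 := h2 g hg0 hg1
        rw [hg] at h3
        exact hg0 (hτ (he.injective _ h3))
      rw [← hg1, hua g hg0, hg, ← hb, hu j f₀ hj]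
    · exfalso
      push Not at hex
      have h2 : ∀ f, f ≠ f₀ → e b (τ f) = e a (σ f) := fun f h => by
        rw [← hb, hu j f (hex f), hua f h]
      obtain ⟨f, hf, -⟩ := third f₀ f₀
      obtain ⟨f', hf', hff⟩ := third f₀ f
      obtain rfl : b = a := he.linear b a _ _ _ _ (hτ.ne hff) (h2 f' hf') (h2 f hf)
      obtain ⟨g, hg⟩ := hsurj (τ f₀)
      have hg0 : g = f₀ := by
        by_contra hg0
        have h3 := h2 g hg0
        rw [hg] at h3
        exact hg0 (hτ (he.injective _ h3))
      rw [hg0] at hg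
      exact hj (by rw [hb, ← hg, ← hi₀, hf₀])
  have hW₀ := hW f₀ hv
  obtain ⟨j, hj⟩ : ∃ j, y j f₀ ≠ v := by
    by_contra! h
    apply h𝒲.1
    convert hW₀
    ext i
    simp [h i]
  obtain ⟨f₁, h10, -, hu1, -⟩ := key j hj
  have key' : ∀ j, y j f₀ ≠ v → y j f₁ = v ∧ ∀ f₂, f₂ ≠ f₁ → y j f₂ ≠ v := by
    intro j hj
    obtain ⟨f, hf, h1, h2, h3⟩ := key j hj
    obtain rfl := huinj f f₁ hf h10 (h2.trans hu1.symm)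
    exact ⟨h1, h3⟩
  obtain ⟨f₂, h20, h21⟩ := third f₀ f₁
  -- The positions without label v at f₂ are the disjoint union of those at f₀ and those at f₁,
  -- against union-freeness.
  refine h𝒲.2 _ hW₀ _ (hW f₁ (huv f₁ h10)) ?_ ?_
  · rw [Set.disjoint_left]
    exact fun i hi hi' => hi' (key' i hi).1
  · convert hW f₂ (huv f₂ h20) using 1
    ext i
    simp only [Set.mem_union, Set.mem_ofPred_eq]
    have nonconst : (y i f₁ ≠ v ∨ y i f₂ ≠ v) → ¬ ∀ f f', y i f = y i f' := by
      intro h hc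
      have h2 : y i f₂ ≠ v := h.elim (fun h => hc f₁ f₂ ▸ h) id
      have h1 : y i f₁ ≠ v := hc f₂ f₁ ▸ h2
      exact h21 (huinj f₂ f₁ h20 h10 (by rw [← hu i f₂ h2, ← hu i f₁ h1, hc f₂ f₁]))
    constructor
    · rintro (h | h)
      · exact (key' i h).2 f₂ h21
      · obtain ⟨b, τ, hτ, hb⟩ := (hy i).resolve_left (nonconst (Or.inl h))
        have h0 : y i f₀ = v := by
          by_contra h0
          exact h (key' i h0).1
        exact fun h2 => h20 (hinj hτ hb (h2.trans h0.symm))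
    · intro h
      obtain ⟨b, τ, hτ, hb⟩ := (hy i).resolve_left (nonconst (Or.inr h))
      by_contra! h'
      exact h10 (hinj hτ hb (h'.2.trans h'.1.symm))

/-- Each position of a quasi-line is constant or a quasi-line of old words, so faithfulness reduces
to `label_mem_edges`. For the Ramsey property, a Hales–Jewett line over the words labelled v is
fixed; filling its wildcards with old words p pulls the colouring back to the old picture, and all p
labelled v get one colour. -/
theorem IsPicture.amalgam [Fintype K] (hK : 3 ≤ Fintype.card K) {e : E → K → V}
    (he : IsLinearSystem e) {C : Type} {S : Set V} {Lab : (κ → K) → V → Prop}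
    (hL : IsPicture e C S Lab) (v : V) {𝒲 : Set (Set ι)} (h𝒲 : UnionFree 𝒲)
    (hHJ : HalesJewettFor {w // Lab w v} C 𝒲) :
    IsPicture e C (insert v S) (amalgam Lab v 𝒲) := by
  classical
  have hfun := hL.functional
  have hne : ∀ W ∈ 𝒲, ∃ i, i ∈ W := by
    intro W hW
    by_contra! h
    exact h𝒲.1 (Set.eq_empty_iff_forall_notMem.mpr h ▸ hW)
  refine ⟨?_, ?_, ?_⟩
  · rintro w u u' (⟨rfl, h1⟩ | ⟨h1, p, hp, W, hW, hin, hout⟩)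
      (⟨rfl, h1'⟩ | ⟨h1', p', hp', W', hW', hin', hout'⟩)
    · rfl
    · obtain ⟨i, hi⟩ := hne W' hW'
      have := h1 i
      rw [hin' i hi] at this
      exact hfun _ _ _ this hp'
    · obtain ⟨i, hi⟩ := hne W hW
      have := h1' i
      rw [hin i hi] at this
      exact hfun _ _ _ hp this
    · obtain ⟨i, hi⟩ := hne W hW
      by_cases hi' : i ∈ W'
      · rw [← hin i hi, hin' i hi'] at hp
        exact hfun _ _ _ hp hp'
      · have := hout' i hi'
        rw [hin i hi] at this
        exact (h1 (hfun _ _ _ hp this)).elim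
  · intro g hg u hu
    have hlet : ∀ i f, ∃ y, Lab (fun x => g f (i, x)) y ∧ (y ≠ v → y = u f) := by
      intro i f
      rcases hu f with ⟨-, h⟩ | ⟨-, p, hp, W, -, hin, hout⟩
      · exact ⟨v, h i, fun h => (h rfl).elim⟩
      · by_cases hi : i ∈ W
        · exact ⟨u f, by rw [hin i hi]; exact hp, fun _ => rfl⟩
        · exact ⟨v, hout i hi, fun h => (h rfl).elim⟩
    choose y hy hyu using hlet
    refine label_mem_edges hK he v h𝒲 y u hyu ?_ ?_ ?_
    · intro f hf
      rcases hu f with ⟨h, -⟩ | ⟨-, p, hp, W, hW, hin, hout⟩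
      · exact (hf h).elim
      · convert hW using 1
        ext i
        constructor
        · intro h
          by_contra hi
          exact h (hfun _ _ _ (hy i f) (hout i hi))
        · intro hi h
          have := hy i f
          rw [h, hin i hi] at this
          exact hf (hfun _ _ _ hp this)
    · intro i
      by_cases hc : ∃ x, Function.Injective fun f => g f (i, x)
      · exact Or.inr (hL.faithful _ ⟨hc, fun x => hg.2 (i, x)⟩ (y i) (hy i))
      · push Not at hc
        left
        intro f f'
        have : (fun x => g f (i, x)) = fun x => g f' (i, x) :=
          funext fun x => (hg.2 (i, x)).resolve_left (hc x) f f'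
        have h := hy i f
        rw [this] at h
        exact hfun _ _ _ h (hy i f')
    · obtain ⟨⟨i, x⟩, hx⟩ := hg.1
      exact ⟨i, hL.faithful _ ⟨⟨x, hx⟩, fun x => hg.2 (i, x)⟩ (y i) (hy i)⟩
  · intro c
    obtain ⟨Λ, hΛ, hcol⟩ := hHJ (fun w => c fun z => (w z.1).1 z.2)
    obtain ⟨χ, hχ⟩ := hL.ramsey (fun p => c fun z => (Λ z.1).elim p Subtype.val z.2)
    have hconst : ∃ j, ∀ p, Lab p v → c (fun z => (Λ z.1).elim p Subtype.val z.2) = j := by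
      have conv : ∀ p : {w // Lab w v}, (fun z : ι × κ => ((Λ z.1).getD p).1 z.2) =
          fun z => (Λ z.1).elim p.1 Subtype.val z.2 := by
        intro p; ext ⟨i, x⟩; cases Λ i <;> simp
      by_cases hA : ∃ p, Lab p v
      · obtain ⟨p₀, hp₀⟩ := hA
        refine ⟨c fun z => (Λ z.1).elim p₀ Subtype.val z.2, fun p hp => ?_⟩
        have := hcol ⟨p, hp⟩ ⟨p₀, hp₀⟩
        rwa [conv, conv] at this
      · push Not at hA
        exact ⟨χ v, fun p hp => (hA p hp).elim⟩
    obtain ⟨j, hj⟩ := hconst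
    refine ⟨Function.update χ v j, fun a => ?_⟩
    obtain ⟨L, ⟨x, hx⟩, hlab, hc⟩ := hχ a
    have hpt : ∀ f, linePoint (fun z : ι × κ => (Λ z.1).elim (L z.2) fun p => some (p.1 z.2)) f =
        fun z => (Λ z.1).elim (linePoint L f) Subtype.val z.2 := by
      intro f; ext ⟨i, x⟩; cases h : Λ i <;> simp [h, linePoint]
    refine ⟨fun z => (Λ z.1).elim (L z.2) fun p => some (p.1 z.2), ?_, fun f => ?_, fun f hf => ?_⟩
    · obtain ⟨i, hi⟩ := hne _ hΛ
      have hi : Λ i = none := hi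
      exact ⟨(i, x), by simp [hi, hx]⟩
    · rw [hpt]
      by_cases hv : e a f = v
      · refine Or.inl ⟨hv, fun i => ?_⟩
        cases h : Λ i with
        | none => simpa [h, hv] using hlab f
        | some p => simpa [h] using p.2
      · refine Or.inr ⟨hv, linePoint L f, hlab f, _, hΛ, fun i hi => ?_, fun i hi => ?_⟩
        · have hi : Λ i = none := hi
          simp [hi]
        · cases h : Λ i with
          | none => exact (hi h).elim
          | some p => simpa [h] using p.2
    · rw [hpt]
      by_cases hv : e a f = v
      · rw [hv, Function.update_self]
        exact hj _ (hv ▸ hlab f)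
      · rw [Function.update_of_ne hv]
        exact hc f (hf.resolve_left hv)

end Amalgamation

theorem exists_picture {K V E : Type} [Fintype K] (hK : 3 ≤ Fintype.card K) [Finite E] [Finite V]
    {e : E → K → V} (he : IsLinearSystem e) (C : Type) [Finite C] [Nonempty C] :
    ∃ (κ : Type) (_ : Finite κ) (Lab : (κ → K) → V → Prop), IsPicture e C Set.univ Lab := by
  have := Fintype.ofFinite V
  suffices h : ∀ S : Finset V, ∃ (κ : Type) (_ : Finite κ) (Lab : (κ → K) → V → Prop),
      IsPicture e C (S : Set V) Lab by
    simpa using h Finset.univ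
  classical
  intro S
  induction S using Finset.induction_on with
  | empty => simpa using exists_base_picture hK e C
  | insert v S _ ih =>
    obtain ⟨κ, _, Lab, hL⟩ := ih
    obtain ⟨ι, _, 𝒲, h𝒲, hHJ⟩ := exists_unionFree_halesJewett {w // Lab w v} C
    refine ⟨ι × κ, inferInstance, _root_.amalgam Lab v 𝒲, ?_⟩
    rw [Finset.coe_insert]
    exact hL.amalgam hK he v h𝒲 hHJ

/-! ### Ramsey's theorem by ultrafilters -/

section Ramsey

open Filter

theorem exists_forall_eventually_eq {C : Type*} [Finite C] (U : Ultrafilter ℕ) (c : ℕ → C) :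
    ∃ j, ∀ᶠ x in (U : Filter ℕ), c x = j := by
  obtain ⟨j, hj⟩ := (U.map c).eq_pure_of_finite
  refine ⟨j, ?_⟩
  have : ({j} : Set C) ∈ U.map c := by rw [hj]; exact Set.mem_singleton j
  exact this

/-- D i is the i-fold ultrafilter limit of c under adding points. B grows point by point so that
every D i S with i + |S| = m equals D m ∅. -/
theorem exists_monochromatic_infinite {C : Type*} [Finite C] (m : ℕ) (c : Finset ℕ → C) (l : ℕ) :
    ∃ B : Finset ℕ, B.card = l ∧ ∃ j, ∀ S ⊆ B, S.card = m → c S = j := by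
  classical
  set U := hyperfilter ℕ
  choose lim hlim using fun d : Finset ℕ → C => fun S : Finset ℕ =>
    exists_forall_eventually_eq U (fun x => d (insert x S))
  let D : ℕ → Finset ℕ → C := fun i => lim^[i] c
  have hD : ∀ i S, ∀ᶠ x in (U : Filter ℕ), D i (insert x S) = D (i + 1) S := by
    intro i S
    have := hlim (D i) S
    simpa only [D, Function.iterate_succ_apply'] using this
  suffices h : ∃ B : Finset ℕ, B.card = l ∧ ∀ S ⊆ B, ∀ i, i + S.card = m → D i S = D m ∅ by
    obtain ⟨B, hB, h⟩ := h
    exact ⟨B, hB, D m ∅, fun S hS hm => h S hS 0 (by omega)⟩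
  induction l with
  | zero =>
    refine ⟨∅, rfl, fun S hS i hi => ?_⟩
    rw [Finset.subset_empty] at hS
    subst hS
    simp at hi
    rw [hi]
  | succ l ih =>
    obtain ⟨B, hB, h⟩ := ih
    have h1 : ∀ᶠ x in (U : Filter ℕ), ∀ S ∈ B.powerset, ∀ i ∈ Finset.range m,
        D i (insert x S) = D (i + 1) S := by
      rw [Filter.eventually_all_finset]
      intro S _
      rw [Filter.eventually_all_finset]
      exact fun i _ => hD i S
    have h2 : ∀ᶠ x in (U : Filter ℕ), x ∉ B :=
      hyperfilter_le_cofinite B.finite_toSet.compl_mem_cofinite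
    obtain ⟨x, hx1, hx2⟩ := (h1.and h2).exists
    refine ⟨insert x B, by rw [Finset.card_insert_of_notMem hx2, hB], fun S hS i hi => ?_⟩
    by_cases hx : x ∈ S
    · have hsub : S.erase x ⊆ B := by rwa [← Finset.subset_insert_iff]
      have hcard := Finset.card_erase_add_one hx
      rw [← Finset.insert_erase hx, hx1 _ (Finset.mem_powerset.mpr hsub) i
        (Finset.mem_range.mpr (by omega))]
      exact h _ hsub _ (by omega)
    · exact h S ((Finset.subset_insert_iff_of_notMem hx).mp hS) i hi

/-- The finite Ramsey theorem for sets of size `m`. -/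
theorem exists_monochromatic_finite (C : Type*) [Finite C] (m l : ℕ) :
    ∃ n, ∀ c : Finset ℕ → C, ∃ B : Finset ℕ, B.card = l ∧ (∀ x ∈ B, x < n) ∧
      ∃ j, ∀ S ⊆ B, S.card = m → c S = j := by
  by_contra! h
  choose c hc using h
  -- Compactness: the counterexamples converge along the ultrafilter to one colouring of all finite
  -- sets.
  choose lim hlim using fun S : Finset ℕ =>
    exists_forall_eventually_eq (hyperfilter ℕ) (fun n => c n S)
  obtain ⟨B, hB, j, hj⟩ := exists_monochromatic_infinite m lim l
  have h1 : ∀ᶠ n in (hyperfilter ℕ : Filter ℕ), ∀ S ∈ B.powerset, c n S = lim S := by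
    rw [Filter.eventually_all_finset]
    exact fun S _ => hlim S
  have h2 : ∀ᶠ n in (hyperfilter ℕ : Filter ℕ), ∀ x ∈ B, x < n := by
    rw [Filter.eventually_all_finset]
    exact fun x _ => Nat.hyperfilter_le_atTop (eventually_gt_atTop x)
  obtain ⟨n, hn1, hn2⟩ := (h1.and h2).exists
  obtain ⟨S, hS, hm, hne⟩ := hc n B hB hn2 j
  exact hne (by rw [hn1 S (Finset.mem_powerset.mpr hS), hj S hS hm])

end Ramsey

/-! ### The deletion hypergraph -/

section Deletions

variable {k s n : ℕ}

/-- The `(a * s)`-th index among `(k - 1) * s + 1` many. -/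
def cut (s : ℕ) (a : Fin k) : Fin ((k - 1) * s + 1) :=
  ⟨a * s, Nat.lt_succ_of_le (Nat.mul_le_mul_right s (by omega))⟩

/-- The vertices obtained from the increasing sequence `b` by deleting one of the terms with the
indices `0, s, 2 * s, …, (k - 1) * s`. -/
def deletion (k s n : ℕ) (b : {b : Fin ((k - 1) * s + 1) → Fin n // StrictMono b}) (a : Fin k) :
    Fin ((k - 1) * s) → Fin n :=
  b.1 ∘ (cut s a).succAbove

theorem cut_injective (hs : 0 < s) : Function.Injective (cut (k := k) s) := by
  intro a a' h
  exact Fin.ext (Nat.eq_of_mul_eq_mul_right hs (congrArg Fin.val h))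

theorem range_deletion (b : {b : Fin ((k - 1) * s + 1) → Fin n // StrictMono b}) (a : Fin k) :
    Set.range (deletion k s n b a) = Set.range b.1 \ {b.1 (cut s a)} := by
  rw [deletion, Set.range_comp, Fin.range_succAbove, Set.image_compl_eq_range_sdiff_image
    b.2.injective, Set.image_singleton]

/-- Two different deletions of b together cover its range, which determines the increasing sequence
b. -/
theorem isLinearSystem_deletion (hs : 0 < s) : IsLinearSystem (deletion k s n) := by
  have hinj : ∀ b, Function.Injective (deletion k s n b) := by
    intro b a a' h
    by_contra hne
    have h1 : b.1 (cut s a) ∈ Set.range (deletion k s n b a') := by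
      rw [range_deletion]
      exact ⟨⟨_, rfl⟩, fun h => hne (cut_injective hs (b.2.injective h))⟩
    rw [← h, range_deletion] at h1
    exact h1.2 rfl
  refine ⟨hinj, fun b b' f f' g g' hff h h' => ?_⟩
  have hu : ∀ (b : {b : Fin ((k - 1) * s + 1) → Fin n // StrictMono b}) (f f' : Fin k), f ≠ f' →
      Set.range (deletion k s n b f) ∪ Set.range (deletion k s n b f') = Set.range b.1 := by
    intro b f f' hff
    rw [range_deletion, range_deletion]
    ext x
    have : b.1 (cut s f) ≠ b.1 (cut s f') := fun h => hff (cut_injective hs (b.2.injective h))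
    simp only [Set.mem_union, Set.mem_sdiff, Set.mem_singleton_iff]
    constructor
    · tauto
    · intro hx
      by_cases h : x = b.1 (cut s f)
      · exact Or.inr ⟨hx, h ▸ this⟩
      · exact Or.inl ⟨hx, h⟩
  have hgg : g ≠ g' := by
    rintro rfl
    exact hff (hinj b (h.trans h'.symm))
  have := hu b f f' hff
  rw [h, h', hu b' g g' hgg] at this
  exact Subtype.ext ((b.2.range_inj b'.2).mp this.symm)

theorem exists_monochromatic_deletions (C : Type*) [Finite C] (k s : ℕ) :
    ∃ n, 0 < n ∧ ∀ c : (Fin ((k - 1) * s) → Fin n) → C,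
      ∃ b, ∃ j, ∀ a, c (deletion k s n b a) = j := by
  set m := (k - 1) * s with hm
  obtain ⟨n, hn⟩ := exists_monochromatic_finite C m (m + 1)
  refine ⟨n + 1, n.succ_pos, fun c => ?_⟩
  -- Only m-subsets of B matter; on these `Fin.ofNat` does not wrap around.
  obtain ⟨B, hB, hBn, j, hj⟩ := hn (fun S => if h : S.card = m then
    c (fun i => Fin.ofNat (n + 1) (S.orderEmbOfFin h i)) else c (fun _ => 0))
  have hlt : ∀ i, B.orderEmbOfFin hB i < n + 1 := fun i =>
    (hBn _ (B.orderEmbOfFin_mem hB i)).trans n.lt_succ_self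
  refine ⟨⟨fun i => ⟨B.orderEmbOfFin hB i, hlt i⟩, fun i i' h =>
    (B.orderEmbOfFin hB).strictMono h⟩, j, fun a => ?_⟩
  set S := Finset.univ.map ((cut s a).succAboveEmb.trans (B.orderEmbOfFin hB).toEmbedding) with hS
  have hSB : S ⊆ B := by
    intro x hx
    simp only [hS, Finset.mem_map] at hx
    obtain ⟨i, -, rfl⟩ := hx
    exact B.orderEmbOfFin_mem hB _
  have hcard : S.card = m := by simp [hS, hm]
  have h1 := hj S hSB hcard
  rw [dif_pos hcard] at h1
  rw [← h1]
  congr 1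
  have h2 := Finset.orderEmbOfFin_unique hcard
    (f := fun i => B.orderEmbOfFin hB ((cut s a).succAbove i))
    (fun i => by simp only [hS, Finset.mem_map]; exact ⟨i, Finset.mem_univ _, rfl⟩)
    ((B.orderEmbOfFin hB).strictMono.comp (Fin.strictMono_succAbove _))
  ext i
  have h3 := congrFun h2 i
  simp only [deletion, Function.comp, Fin.ofNat, ← h3]
  rw [Nat.mod_eq_of_lt (hlt _)]

end Deletions

/-! ### Random hitting sets from marks -/

section Markers

variable {k s n q : ℕ}

/-- The `i`-th term of `x` is marked, that is, receives the value `0` under `h`. -/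
def Marked {m : ℕ} (h : Fin n → Fin (q + 1)) (x : Fin m → Fin n) (i : ℕ) : Prop :=
  ∃ hi : i < m, h (x ⟨i, hi⟩) = 0

/-- The position of the first mark in the `j`-th window `[j * s, (j + 1) * s)`. -/
noncomputable def firstMark {m : ℕ} (s : ℕ) (h : Fin n → Fin (q + 1)) (x : Fin m → Fin n)
    (j : ℕ) : ℕ :=
  sInf {t | Marked h x (j * s + t)}

/-- Every window contains a mark, but does not start with one. -/
def WellMarked {m : ℕ} (k s : ℕ) (h : Fin n → Fin (q + 1)) (x : Fin m → Fin n) : Prop :=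
  ∀ j < k - 1, ¬ Marked h x (j * s) ∧ ∃ t < s, Marked h x (j * s + t)

theorem marked_deletion_of_lt (h : Fin n → Fin (q + 1))
    (b : {b : Fin ((k - 1) * s + 1) → Fin n // StrictMono b}) (a : Fin k) {i : ℕ}
    (hi : i < a * s) : Marked h (deletion k s n b a) i ↔ Marked h b.1 i := by
  have ha : a * s ≤ (k - 1) * s := Nat.mul_le_mul_right s (by omega)
  have key : ∀ hi' : i < (k - 1) * s, deletion k s n b a ⟨i, hi'⟩ = b.1 ⟨i, by omega⟩ := by
    intro hi'
    rw [deletion, Function.comp, Fin.succAbove_of_castSucc_lt]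
    · rfl
    · exact hi
  constructor
  · rintro ⟨hi', h0⟩
    exact ⟨by omega, by rwa [key] at h0⟩
  · rintro ⟨hi', h0⟩
    exact ⟨by omega, by rwa [key]⟩

theorem marked_deletion_of_le (h : Fin n → Fin (q + 1))
    (b : {b : Fin ((k - 1) * s + 1) → Fin n // StrictMono b}) (a : Fin k) {i : ℕ}
    (hi : a * s ≤ i) : Marked h (deletion k s n b a) i ↔ Marked h b.1 (i + 1) := by
  have key : ∀ hi' : i < (k - 1) * s, deletion k s n b a ⟨i, hi'⟩ = b.1 ⟨i + 1, by omega⟩ := by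
    intro hi'
    rw [deletion, Function.comp, Fin.succAbove_of_le_castSucc]
    · rfl
    · exact hi
  constructor
  · rintro ⟨hi', h0⟩
    exact ⟨by omega, by rwa [key] at h0⟩
  · rintro ⟨hi', h0⟩
    exact ⟨by omega, by rwa [key]⟩

/-- Deleting the term a * s leaves windows before a alone and shifts the later ones by one. No mark
is lost at the left end of window j: the last deletion agrees with b there, and it is well marked.
-/
theorem firstMark_deletion (hs : 0 < s) (h : Fin n → Fin (q + 1))
    (b : {b : Fin ((k - 1) * s + 1) → Fin n // StrictMono b})
    (hgood : ∀ a, WellMarked k s h (deletion k s n b a)) (a : Fin k) {j : ℕ} (hj : j < k - 1) :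
    firstMark s h b.1 j = firstMark s h (deletion k s n b a) j + if a ≤ j then 1 else 0 := by
  obtain ⟨-, t, hts, ht⟩ := hgood a j hj
  split_ifs with haj
  · have has : ∀ t, a * s ≤ j * s + t := fun t =>
      (Nat.mul_le_mul_right s haj).trans (Nat.le_add_right _ _)
    have h0 : ¬ Marked h b.1 (j * s) := by
      have hlt : j * s < ((⟨k - 1, by omega⟩ : Fin k) : ℕ) * s := Nat.mul_lt_mul_of_pos_right hj hs
      rw [← marked_deletion_of_lt h b ⟨k - 1, by omega⟩ hlt]
      exact (hgood _ j hj).1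
    have hmem : Marked h (deletion k s n b a)
        (j * s + firstMark s h (deletion k s n b a) j) :=
      Nat.sInf_mem (s := {t | Marked h (deletion k s n b a) (j * s + t)}) ⟨t, ht⟩
    have hmem' : firstMark s h (deletion k s n b a) j + 1 ∈ {t | Marked h b.1 (j * s + t)} :=
      (marked_deletion_of_le h b a (has _)).mp hmem
    apply le_antisymm
    · exact Nat.sInf_le hmem'
    · have hmin : Marked h b.1 (j * s + firstMark s h b.1 j) :=
        Nat.sInf_mem (s := {t | Marked h b.1 (j * s + t)}) ⟨_, hmem'⟩
      rcases Nat.eq_zero_or_pos (firstMark s h b.1 j) with hz | hp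
      · rw [hz] at hmin
        exact (h0 hmin).elim
      · obtain ⟨r, hr⟩ := Nat.exists_eq_succ_of_ne_zero hp.ne'
        rw [hr] at hmin ⊢
        exact Nat.succ_le_succ
          (Nat.sInf_le (s := {t | Marked h (deletion k s n b a) (j * s + t)})
            ((marked_deletion_of_le h b a (has r)).mpr hmin))
  · have has : ∀ t < s, j * s + t < a * s := fun t ht => by
      have := Nat.mul_le_mul_right s (show j + 1 ≤ a by omega)
      rw [Nat.succ_mul] at this
      omega
    rw [add_zero]
    apply le_antisymm
    · have hle : firstMark s h (deletion k s n b a) j ≤ t :=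
        Nat.sInf_le (s := {t | Marked h (deletion k s n b a) (j * s + t)}) ht
      have hmem : Marked h (deletion k s n b a)
          (j * s + firstMark s h (deletion k s n b a) j) :=
        Nat.sInf_mem (s := {t | Marked h (deletion k s n b a) (j * s + t)}) ⟨t, ht⟩
      exact Nat.sInf_le (s := {t | Marked h b.1 (j * s + t)})
        ((marked_deletion_of_lt h b a (has _ (hle.trans_lt hts))).mp hmem)
    · have ht' := (marked_deletion_of_lt h b a (has t hts)).mp ht
      have hle : firstMark s h b.1 j ≤ t :=
        Nat.sInf_le (s := {t | Marked h b.1 (j * s + t)}) ht'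
      have hmem : Marked h b.1 (j * s + firstMark s h b.1 j) :=
        Nat.sInf_mem (s := {t | Marked h b.1 (j * s + t)}) ⟨t, ht'⟩
      exact Nat.sInf_le (s := {t | Marked h (deletion k s n b a) (j * s + t)})
        ((marked_deletion_of_lt h b a (has _ (hle.trans_lt hts))).mpr hmem)

theorem sum_range_indicator_le (a l : ℕ) (ha : a ≤ l) :
    ∑ j ∈ Finset.range l, (if a ≤ j then 1 else 0) + a = l := by
  induction l with
  | zero => simp_all
  | succ l ih =>
    rw [Finset.sum_range_succ]
    rcases Nat.lt_or_ge l a with h | h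
    · obtain rfl : a = l + 1 := by omega
      have : ∑ j ∈ Finset.range l, (if l + 1 ≤ j then 1 else 0) = 0 :=
        Finset.sum_eq_zero fun j hj => if_neg (by have := Finset.mem_range.mp hj; omega)
      rw [if_neg (by omega), this]
      omega
    · rw [if_pos h]
      have := ih h
      omega

/-- A set of vertices meeting every edge of the deletion system. -/
def hittingSet (k s : ℕ) (h : Fin n → Fin (q + 1)) (θ : ZMod k) :
    Set (Fin ((k - 1) * s) → Fin n) :=
  {x | Function.Injective x ∧
    (WellMarked k s h x → ((∑ j ∈ Finset.range (k - 1), firstMark s h x j : ℕ) : ZMod k) = θ)}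

/-- A deletion that is not well marked belongs by default. Otherwise the a-th deletion has first
marks summing to P - (k - 1 - a), so the k deletions realise every residue modulo k. -/
theorem exists_deletion_mem_hittingSet (hk : 0 < k) (hs : 0 < s) (h : Fin n → Fin (q + 1))
    (θ : ZMod k) (b : {b : Fin ((k - 1) * s + 1) → Fin n // StrictMono b}) :
    ∃ a, deletion k s n b a ∈ hittingSet k s h θ := by
  have := NeZero.of_pos hk
  by_contra! hnot
  have hinj : ∀ a, Function.Injective (deletion k s n b a) := fun a =>
    b.2.injective.comp Fin.succAbove_right_injective
  have hgood : ∀ a, WellMarked k s h (deletion k s n b a) := by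
    intro a
    by_contra hbad
    exact hnot a ⟨hinj a, fun hg => (hbad hg).elim⟩
  set P := ∑ j ∈ Finset.range (k - 1), firstMark s h b.1 j with hP
  set a : ZMod k := θ - P + (k - 1 : ℕ) with ha
  have hlt := ZMod.val_lt a
  refine hnot ⟨a.val, hlt⟩ ⟨hinj _, fun _ => ?_⟩
  have hsum : P + a.val = ∑ j ∈ Finset.range (k - 1),
      firstMark s h (deletion k s n b ⟨a.val, hlt⟩) j + (k - 1) := by
    rw [hP, Finset.sum_congr rfl fun j hj =>
      firstMark_deletion hs h b hgood ⟨a.val, hlt⟩ (Finset.mem_range.mp hj),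
      Finset.sum_add_distrib, add_assoc, sum_range_indicator_le _ _ (by simp; omega)]
  have hcast := congrArg (Nat.cast (R := ZMod k)) hsum
  push_cast only [Nat.cast_add] at hcast
  rw [ZMod.natCast_zmod_val,
    show (P : ZMod k) + a = θ + ((k - 1 : ℕ) : ZMod k) by rw [ha]; ring] at hcast
  exact (add_right_cancel hcast).symm

end Markers

/-! ### Density of the hitting sets -/

section Counting

open Finset

theorem card_functions_mem_mul {α β : Type*} [Fintype α] [DecidableEq α] [Fintype β]
    [DecidableEq β] (A : Finset α) (B : Finset β) :
    #{h : α → β | ∀ i ∈ A, h i ∈ B} * Fintype.card β ^ #A =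
      #B ^ #A * Fintype.card β ^ Fintype.card α := by
  have h1 : ({h : α → β | ∀ i ∈ A, h i ∈ B} : Finset (α → β)) =
      Fintype.piFinset fun i => if i ∈ A then B else univ := by
    ext h
    simp only [mem_filter, mem_univ, true_and, Fintype.mem_piFinset]
    refine forall_congr' fun i => ?_
    by_cases hi : i ∈ A <;> simp [hi]
  have h2 : #(univ \ A) + #A = Fintype.card α := by
    rw [card_sdiff_add_card_eq_card (subset_univ A), card_univ]
  rw [h1, Fintype.card_piFinset]
  have h3 : ∏ i, #(if i ∈ A then B else univ) = #B ^ #A * Fintype.card β ^ #(univ \ A) := by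
    rw [← prod_sdiff (subset_univ A), mul_comm]
    congr 1
    · rw [prod_congr rfl fun i hi => by rw [if_pos hi], prod_const]
    · rw [prod_congr rfl fun i hi => by rw [if_neg (mem_sdiff.mp hi).2], prod_const, card_univ]
  rw [h3, ← h2, pow_add]
  ring

/-- Union bound over the windows: a mark at the start has probability 1 / (q + 1), no mark at all (q
/ (q + 1)) ^ s, since x has s distinct values in a window. -/
theorem card_wellMarked {k s n q : ℕ} (hs : 0 < s) (x : Fin ((k - 1) * s) → Fin n)
    (hx : Function.Injective x) [DecidablePred fun h : Fin n → Fin (q + 1) => WellMarked k s h x] :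
    ((q : ℝ) + 1) ^ n * (1 - (k - 1 : ℕ) * (1 / ((q : ℝ) + 1) + (q / ((q : ℝ) + 1)) ^ s)) ≤
      #{h : Fin n → Fin (q + 1) | WellMarked k s h x} := by
  classical
  have hQ : (0 : ℝ) < q + 1 := by positivity
  have hidx : ∀ j < k - 1, ∀ t < s, j * s + t < (k - 1) * s := by
    intro j hj t ht
    have := Nat.mul_le_mul_right s (show j + 1 ≤ k - 1 by omega)
    rw [Nat.succ_mul] at this
    omega
  let win : ℕ → Finset (Fin n) := fun j =>
    univ.filter fun y => ∃ t < s, ∃ h : j * s + t < (k - 1) * s, x ⟨j * s + t, h⟩ = y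
  have hwin : ∀ j < k - 1, #(win j) = s := by
    intro j hj
    have : win j = univ.map ⟨fun t : Fin s => x ⟨j * s + t, hidx j hj t t.2⟩, fun t t' h => by
        have := congrArg Fin.val (hx h)
        exact Fin.ext (by simpa using this)⟩ := by
      ext y
      simp only [win, mem_filter, mem_univ, true_and, mem_map]
      constructor
      · rintro ⟨t, ht, h, rfl⟩
        exact ⟨⟨t, ht⟩, rfl⟩
      · rintro ⟨t, rfl⟩
        exact ⟨t, t.2, _, rfl⟩
    rw [this, card_map, card_univ, Fintype.card_fin]
  let bad₁ : ℕ → Finset (Fin n → Fin (q + 1)) := fun j => univ.filter fun h => Marked h x (j * s)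
  let bad₂ : ℕ → Finset (Fin n → Fin (q + 1)) := fun j =>
    univ.filter fun h => ∀ i ∈ win j, h i ∈ (univ.erase 0 : Finset (Fin (q + 1)))
  have hb₁ : ∀ j < k - 1, (#(bad₁ j) : ℝ) = (q + 1) ^ n * (1 / (q + 1)) := by
    intro j hj
    have h0 := hidx j hj 0 hs
    have := card_functions_mem_mul {x ⟨j * s, h0⟩} ({0} : Finset (Fin (q + 1)))
    simp only [card_singleton, pow_one, one_mul, Fintype.card_fin, mem_singleton,
      forall_eq] at this
    have h1 : bad₁ j = univ.filter fun h : Fin n → Fin (q + 1) => h (x ⟨j * s, h0⟩) = 0 := by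
      ext h
      simp only [bad₁, mem_filter, mem_univ, true_and]
      exact ⟨fun ⟨_, h⟩ => h, fun h => ⟨h0, h⟩⟩
    rw [← h1] at this
    have h2 := congrArg (Nat.cast (R := ℝ)) this
    push_cast at h2
    rw [← h2]
    field_simp
  have hb₂ : ∀ j < k - 1, (#(bad₂ j) : ℝ) = (q + 1) ^ n * (q / (q + 1)) ^ s := by
    intro j hj
    have := card_functions_mem_mul (win j) (univ.erase 0 : Finset (Fin (q + 1)))
    rw [hwin j hj, card_erase_of_mem (mem_univ _), card_univ, Fintype.card_fin, Fintype.card_fin,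
      Nat.add_sub_cancel] at this
    have h2 := congrArg (Nat.cast (R := ℝ)) this
    push_cast at h2
    rw [div_pow, mul_div_assoc', eq_div_iff (by positivity)]
    rw [mul_comm ((q + 1 : ℝ) ^ n), ← h2]
    congr!
  have hcover : (univ : Finset (Fin n → Fin (q + 1))) ⊆
      (univ.filter fun h => WellMarked k s h x) ∪
        (range (k - 1)).biUnion fun j => bad₁ j ∪ bad₂ j := by
    intro h _
    by_cases hg : WellMarked k s h x
    · exact mem_union_left _ (by simpa using hg)
    · refine mem_union_right _ ?_
      unfold WellMarked at hg
      push Not at hg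
      obtain ⟨j, hj, hg⟩ := hg
      refine mem_biUnion.mpr ⟨j, mem_range.mpr hj, mem_union.mpr ?_⟩
      by_cases hm : Marked h x (j * s)
      · left; simpa [bad₁] using hm
      · right
        simp only [bad₂, win, mem_filter, mem_univ, true_and, mem_erase, and_true]
        rintro _ ⟨t, ht, hlt, rfl⟩ h0
        exact hg hm t ht ⟨hlt, h0⟩
  have hcard : ((q : ℝ) + 1) ^ n ≤ #{h : Fin n → Fin (q + 1) | WellMarked k s h x} +
      ∑ j ∈ range (k - 1), ((#(bad₁ j) : ℝ) + #(bad₂ j)) := by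
    have h1 := (card_le_card hcover).trans ((card_union_le _ _).trans
      (Nat.add_le_add_left (card_biUnion_le.trans (sum_le_sum fun j _ => card_union_le _ _)) _))
    rw [card_univ, Fintype.card_fun, Fintype.card_fin, Fintype.card_fin] at h1
    exact_mod_cast h1
  rw [sum_congr rfl fun j hj => by rw [hb₁ j (mem_range.mp hj), hb₂ j (mem_range.mp hj)],
    sum_const, card_range, nsmul_eq_mul] at hcard
  linarith

/-- A well-marked injective x is missed for all but one of the k residues. Choosing q and then s
makes being well marked almost certain, uniformly in n, so that n may later depend on s. -/
theorem exists_hitting_family {k : ℕ} (hk : 2 ≤ k) {μ : ℝ} (hμ : μ < ((k : ℝ) - 1) / k) :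
    ∃ s, 0 < s ∧ ∀ n, ∃ (Ω : Type) (_ : Fintype Ω) (_ : Nonempty Ω)
      (T : Ω → Set (Fin ((k - 1) * s) → Fin n)), (∀ ω b, ∃ a, deletion k s n b a ∈ T ω) ∧
        ∀ x, μ * Fintype.card Ω ≤ Nat.card {ω // x ∉ T ω} := by
  classical
  have hk0 : (0 : ℝ) < k := by positivity
  have hk1 : (0 : ℝ) < (k : ℝ) - 1 := by
    have : (2 : ℝ) ≤ k := by exact_mod_cast hk
    linarith
  have := NeZero.of_pos (show 0 < k by omega)
  have hkc : ((k - 1 : ℕ) : ℝ) = k - 1 := by rw [Nat.cast_sub (by omega), Nat.cast_one]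
  obtain ⟨ε, hε, hμε⟩ : ∃ ε > 0, μ * k ≤ (1 - ((k : ℝ) - 1) * (ε + ε)) * (k - 1) := by
    -- The solution ε of the inequality taken as an equality.
    refine ⟨((k : ℝ) - 1 - μ * k) / (2 * (k - 1) ^ 2), ?_, le_of_eq ?_⟩
    · rw [lt_div_iff₀ hk0] at hμ
      have : 0 < (k : ℝ) - 1 - μ * k := by linarith
      positivity
    · field_simp
      ring
  obtain ⟨q, hq⟩ := exists_nat_one_div_lt hε
  have hQ : (0 : ℝ) < q + 1 := by positivity
  obtain ⟨s₀, hs₀⟩ := exists_pow_lt_of_lt_one hε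
    (show (q : ℝ) / (q + 1) < 1 by rw [div_lt_one hQ]; linarith)
  have hs : ((q : ℝ) / (q + 1)) ^ (s₀ + 1) < ε := lt_of_le_of_lt
    (pow_le_pow_of_le_one (by positivity) (by rw [div_le_one hQ]; linarith) s₀.le_succ) hs₀
  refine ⟨s₀ + 1, s₀.succ_pos, fun n => ⟨(Fin n → Fin (q + 1)) × ZMod k, inferInstance,
    inferInstance, fun ω => hittingSet k (s₀ + 1) ω.1 ω.2,
    fun ω b => exists_deletion_mem_hittingSet (by omega) s₀.succ_pos ω.1 ω.2 b, fun x => ?_⟩⟩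
  rw [Fintype.card_prod, Fintype.card_fun, Fintype.card_fin, Fintype.card_fin, ZMod.card]
  push_cast
  rw [Nat.card_eq_fintype_card, Fintype.card_subtype]
  have hn : (0 : ℝ) < (q + 1) ^ n := by positivity
  by_cases hx : Function.Injective x
  · have heq : (univ.filter fun ω : (Fin n → Fin (q + 1)) × ZMod k =>
        x ∉ hittingSet k (s₀ + 1) ω.1 ω.2) =
        ((univ.filter fun h => WellMarked k (s₀ + 1) h x).sigma fun h => univ.erase
          ((∑ j ∈ range (k - 1), firstMark (s₀ + 1) h x j : ℕ) : ZMod k)).map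
          (Equiv.sigmaEquivProd _ _).toEmbedding := by
      ext ⟨h, θ⟩
      simp only [hittingSet, mem_filter, mem_univ, true_and, Set.mem_ofPred_eq, hx, mem_map_equiv,
        mem_sigma, mem_erase, and_true, Classical.not_imp, Equiv.sigmaEquivProd_symm_apply]
      exact and_congr_right fun _ => ne_comm
    rw [heq, card_map, card_sigma, sum_congr rfl fun h _ => card_erase_of_mem (mem_univ _),
      sum_const, card_univ, ZMod.card, smul_eq_mul]
    push_cast
    rw [hkc]
    have h1 := card_wellMarked (k := k) (q := q) s₀.succ_pos x hx
    rw [hkc] at h1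
    have h2 : ((q : ℝ) + 1) ^ n * (1 - (k - 1) * (ε + ε)) ≤
        ((q : ℝ) + 1) ^ n *
          (1 - (k - 1) * (1 / ((q : ℝ) + 1) + (q / ((q : ℝ) + 1)) ^ (s₀ + 1))) := by
      gcongr
    calc μ * ((q + 1) ^ n * k) = (q + 1) ^ n * (μ * k) := by ring
      _ ≤ (q + 1) ^ n * ((1 - ((k : ℝ) - 1) * (ε + ε)) * (k - 1)) := by gcongr
      _ = ((q + 1) ^ n * (1 - ((k : ℝ) - 1) * (ε + ε))) * (k - 1) := by ring
      _ ≤ _ := by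
        gcongr
        exact h2.trans h1
  · have heq : (univ.filter fun ω : (Fin n → Fin (q + 1)) × ZMod k =>
        x ∉ hittingSet k (s₀ + 1) ω.1 ω.2) = univ := by
      rw [filter_true_of_mem]
      exact fun ω _ h => hx h.1
    rw [heq, card_univ, Fintype.card_prod, Fintype.card_fun, Fintype.card_fin, Fintype.card_fin,
      ZMod.card]
    push_cast
    have hμ1 : μ ≤ 1 := hμ.le.trans (by rw [div_le_one hk0]; linarith)
    nlinarith [mul_pos hn hk0]

end Counting

/-! ### Generic projection of words to lattice points -/

section Geometry

variable {d : ℕ}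

/-- The squared Euclidean norm of a lattice vector. -/
def normSq (v : Fin d → ℤ) : ℤ := ∑ i, v i ^ 2

theorem normSq_eq_zero {v : Fin d → ℤ} : normSq v = 0 ↔ v = 0 := by
  rw [normSq, Finset.sum_eq_zero_iff_of_nonneg fun i _ => sq_nonneg _, funext_iff]
  simp

theorem dist_smul_latticePoint_sq (t : ℝ) (a b : Fin d → ℤ) :
    dist (t • latticePoint a) (t • latticePoint b) ^ 2 = t ^ 2 * (normSq (a - b) : ℝ) := by
  rw [dist_smul₀, mul_pow, EuclideanSpace.dist_eq, Real.sq_sqrt (by positivity)]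
  simp [latticePoint, normSq, Real.dist_eq, sq_abs]

theorem Congruent.sq_mul_normSq {ι : Type*} {a b : ι → Fin d → ℤ} {t : ℝ}
    (h : Congruent (fun i => t • latticePoint (a i)) fun i => latticePoint (b i)) (i j : ι) :
    t ^ 2 * (normSq (a i - a j) : ℝ) = normSq (b i - b j) := by
  have h1 := h i j
  rw [edist_dist, edist_dist, ENNReal.ofReal_eq_ofReal_iff dist_nonneg dist_nonneg] at h1
  have h2 := dist_smul_latticePoint_sq 1 (b i) (b j)
  rw [one_smul, one_smul, ← h1, dist_smul_latticePoint_sq] at h2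
  rw [h2]
  ring

/-- The product of the nonzero p i is a nonzero polynomial, so it cannot vanish at all positive
integer points. -/
theorem exists_pos_generic {κ I : Type*} [Finite I] (p : I → MvPolynomial κ ℤ) :
    ∃ M : κ → ℤ, (∀ x, 0 < M x) ∧
      ∀ i, MvPolynomial.eval M (p i) = 0 → ∀ N, MvPolynomial.eval N (p i) = 0 := by
  classical
  have := Fintype.ofFinite I
  by_contra! h
  have hprod : ∏ i, (if p i = 0 then 1 else p i) = 0 := by
    refine MvPolynomial.funext_set (fun _ => Set.Ioi 0) (fun _ => Set.Ioi_infinite 0) ?_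
    intro M hM
    obtain ⟨i, hi, N, hN⟩ := h M fun x => hM x (Set.mem_univ x)
    rw [map_prod, map_zero]
    refine Finset.prod_eq_zero (Finset.mem_univ i) ?_
    rw [if_neg, hi]
    intro h0
    simp [h0] at hN
  obtain ⟨i, -, hi⟩ := Finset.prod_eq_zero_iff.mp hprod
  split_ifs at hi with h0
  · exact one_ne_zero hi
  · exact h0 hi

variable {F : Finset (Fin d → ℤ)} {κ : Type} [Fintype κ]

/-- The linear combination of the letters of `w` with the coefficients `M`. -/
def combination (M : κ → ℤ) (w : κ → F) : Fin d → ℤ := fun i => ∑ x, M x * (w x).1 i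

/-- Eliminating t between two pairs of points gives polynomial equations in M, which by genericity
hold for all coefficients, in particular unit vectors. So each coordinate scales squared distances
in F by one factor: it is constant or injective. As t ≠ 0, not all are constant. -/
theorem exists_generic_combination (F : Finset (Fin d → ℤ)) (hF : 1 < F.card) (κ : Type)
    [Fintype κ] : ∃ M : κ → ℤ, (∀ x, 0 < M x) ∧ ∀ (g : F → κ → F) (t : ℝ), t ≠ 0 →
      (∀ f f' : F, t ^ 2 * (normSq (f.1 - f'.1) : ℝ) =
        normSq (combination M (g f) - combination M (g f'))) → IsQuasiLine g := by
  classical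
  let I := ((κ → F) × (κ → F) × (κ → F) × (κ → F)) × (F × F × F × F)
  let p : I → MvPolynomial κ ℤ := fun z =>
    MvPolynomial.C (normSq (z.2.2.2.1.1 - z.2.2.2.2.1)) *
      ∑ i, (∑ x, MvPolynomial.X x * MvPolynomial.C ((z.1.1 x).1 i - (z.1.2.1 x).1 i)) ^ 2 -
    MvPolynomial.C (normSq (z.2.1.1 - z.2.2.1.1)) *
      ∑ i, (∑ x, MvPolynomial.X x * MvPolynomial.C ((z.1.2.2.1 x).1 i - (z.1.2.2.2 x).1 i)) ^ 2
  obtain ⟨M, hM, hgen⟩ := exists_pos_generic p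
  refine ⟨M, hM, fun g t ht h => ?_⟩
  have heval : ∀ (N : κ → ℤ) (w w' w'' w''' : κ → F) (f f' e e' : F),
      MvPolynomial.eval N (p ((w, w', w'', w'''), (f, f', e, e'))) =
      normSq (e.1 - e'.1) * normSq (combination N w - combination N w') -
        normSq (f.1 - f'.1) * normSq (combination N w'' - combination N w''') := by
    intro N w w' w'' w''' f f' e e'
    simp [p, normSq, combination, mul_sub, Finset.sum_sub_distrib]
  have hsingle : ∀ (x : κ) (w : κ → F), combination (Pi.single x 1) w = (w x).1 := by
    intro x w
    ext i
    simp [combination, Pi.single_apply]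
  have hcoord : ∀ (x : κ) (f f' e e' : F), normSq (e.1 - e'.1) * normSq ((g f x).1 - (g f' x).1) =
      normSq (f.1 - f'.1) * normSq ((g e x).1 - (g e' x).1) := by
    intro x f f' e e'
    have h1 := hgen ((g f, g f', g e, g e'), (f, f', e, e')) (by
      rw [heval, sub_eq_zero]
      have : (normSq (e.1 - e'.1) : ℝ) * normSq (combination M (g f) - combination M (g f')) =
          normSq (f.1 - f'.1) * normSq (combination M (g e) - combination M (g e')) := by
        rw [← h, ← h]
        ring
      exact_mod_cast this) (Pi.single x 1)
    rwa [heval, hsingle, hsingle, hsingle, hsingle, sub_eq_zero] at h1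
  have hdich : ∀ x, (Function.Injective fun f => g f x) ∨ ∀ f f', g f x = g f' x := by
    intro x
    by_cases hc : ∀ f f', g f x = g f' x
    · exact Or.inr hc
    left
    push Not at hc
    obtain ⟨e, e', he⟩ := hc
    intro f f' hff
    have h1 := hcoord x f f' e e'
    simp only at hff
    rw [hff, sub_self, normSq_eq_zero.mpr rfl, mul_zero, eq_comm, mul_eq_zero, normSq_eq_zero,
      normSq_eq_zero, sub_eq_zero, sub_eq_zero] at h1
    exact Subtype.ext (h1.resolve_right fun h => he (Subtype.ext h))
  refine ⟨?_, hdich⟩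
  by_contra! hno
  obtain ⟨f, hf, f', hf', hne⟩ := Finset.one_lt_card.mp hF
  have heq : g ⟨f, hf⟩ = g ⟨f', hf'⟩ := funext fun x => (hdich x).resolve_left (hno x) _ _
  have h1 := h ⟨f, hf⟩ ⟨f', hf'⟩
  rw [heq, sub_self, normSq_eq_zero.mpr rfl, Int.cast_zero, mul_eq_zero, Int.cast_eq_zero,
    normSq_eq_zero, sub_eq_zero] at h1
  exact h1.elim (pow_ne_zero 2 ht) hne

theorem combination_linePoint (M : κ → ℤ) (L : κ → Option F) (f : F) :
    combination M (linePoint L f) =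
      (fun i => ∑ x, M x * (L x).elim 0 (fun p => p.1 i)) +
        (∑ x, M x * (L x).elim 1 fun _ => 0) • f.1 := by
  ext i
  simp only [combination, linePoint, Pi.add_apply, Pi.smul_apply, smul_eq_mul, Finset.sum_mul,
    ← Finset.sum_add_distrib]
  refine Finset.sum_congr rfl fun x _ => ?_
  cases L x <;> simp

end Geometry

/-! ### Assembly -/

theorem IsLinearSystem.comp_equiv {K K' V E : Type*} {e : E → K → V} (he : IsLinearSystem e)
    (φ : K' ≃ K) : IsLinearSystem fun a f => e a (φ f) :=
  ⟨fun a => (he.injective a).comp φ.injective, fun a b _ _ _ _ hff h h' =>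
    he.linear a b _ _ _ _ (φ.injective.ne hff) h h'⟩

/-- Double counting: on average over ω, at least μ |Y| elements of Y are good. -/
theorem exists_large_member {Ω α : Type*} [Fintype Ω] [Nonempty Ω] (Y : Finset α)
    (good : Ω → α → Prop) (μ : ℝ)
    (h : ∀ y ∈ Y, μ * Fintype.card Ω ≤ Nat.card {ω // good ω y}) :
    ∃ ω, ∃ Z ⊆ Y, (∀ z ∈ Z, good ω z) ∧ μ * (Y.card : ℝ) ≤ Z.card := by
  classical
  have hsum : ∑ _ω : Ω, μ * (Y.card : ℝ) ≤ ∑ ω, ((Y.filter (good ω)).card : ℝ) := by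
    have hswap : ∑ ω, ((Y.filter (good ω)).card : ℝ) =
        ∑ y ∈ Y, (Nat.card {ω // good ω y} : ℝ) := by
      have := Finset.sum_card_bipartiteAbove_eq_sum_card_bipartiteBelow
        (s := (Finset.univ : Finset Ω)) (t := Y) good
      simp only [Finset.bipartiteAbove, Finset.bipartiteBelow] at this
      simp only [Nat.card_eq_fintype_card, Fintype.card_subtype]
      exact_mod_cast this
    rw [hswap, Finset.sum_const, Finset.card_univ, nsmul_eq_mul]
    calc (Fintype.card Ω : ℝ) * (μ * Y.card) = ∑ _y ∈ Y, μ * Fintype.card Ω := by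
          rw [Finset.sum_const, nsmul_eq_mul]; ring
      _ ≤ _ := Finset.sum_le_sum h
  obtain ⟨ω, -, hω⟩ := Finset.exists_le_of_sum_le Finset.univ_nonempty hsum
  exact ⟨ω, Y.filter (good ω), Finset.filter_subset _ _,
    fun z hz => (Finset.mem_filter.mp hz).2, hω⟩

theorem proposition2p2 (d : ℕ) (F : Finset (Fin d → ℤ)) (hF : 3 ≤ F.card)
    (r : ℕ) (hr : 1 ≤ r) (μ : ℝ) (hμ0 : 0 < μ)
    (hμ1 : μ < ((F.card : ℝ) - 1) / (F.card : ℝ)) :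
    ∃ X : Finset (Fin d → ℤ), (∀ x ∈ X, ∀ i, 1 ≤ x i) ∧
      (∀ c : X → Fin r, HasMonochromaticHomotheticCopy F X c) ∧
      (∀ Y ⊆ X, ∃ Z ⊆ Y, IsFreeOf F Z ∧ μ * (Y.card : ℝ) ≤ (Z.card : ℝ)) := by
  classical
  have : Nonempty (Fin r) := ⟨⟨0, hr⟩⟩
  obtain ⟨s, hs, hT⟩ := exists_hitting_family (by omega) hμ1
  obtain ⟨n, -, hn⟩ := exists_monochromatic_deletions (Fin r) F.card s
  obtain ⟨Ω, _, _, T, hhit, hdens⟩ := hT n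
  obtain ⟨κ, _, Lab, hpic⟩ := exists_picture (by simpa using hF)
    ((isLinearSystem_deletion (k := F.card) (n := n) hs).comp_equiv F.equivFin) (Fin r)
  have := Fintype.ofFinite κ
  obtain ⟨M, hM, hgen⟩ := exists_generic_combination F (by omega) κ
  obtain ⟨B, hB⟩ : ∃ B : ℤ, ∀ (w : κ → F) i, 1 ≤ combination M w i + B := by
    refine ⟨1 + ∑ w : κ → F, ∑ i, |combination M w i|, fun w i => ?_⟩
    have h1 : |combination M w i| ≤ ∑ i, |combination M w i| :=
      Finset.single_le_sum (f := fun i => |combination M w i|) (fun _ _ => abs_nonneg _)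
        (Finset.mem_univ i)
    have h2 : ∑ i, |combination M w i| ≤ ∑ w : κ → F, ∑ i, |combination M w i| :=
      Finset.single_le_sum (f := fun w : κ → F => ∑ i, |combination M w i|)
        (fun _ _ => Finset.sum_nonneg fun _ _ => abs_nonneg _) (Finset.mem_univ w)
    have h3 := neg_abs_le (combination M w i)
    omega
  let φ : (κ → F) → Fin d → ℤ := fun w => combination M w + fun _ => B
  have hφ : ∀ w w', φ w - φ w' = combination M w - combination M w' := fun w w' => by
    simp [φ]
  let X : Finset (Fin d → ℤ) := (Finset.univ.filter fun w => ∃ u, Lab w u).image φ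
  have hX : ∀ w u, Lab w u → φ w ∈ X := fun w u h =>
    Finset.mem_image_of_mem φ (Finset.mem_filter.mpr ⟨Finset.mem_univ w, u, h⟩)
  refine ⟨X, ?_, fun c => ?_, fun Y hY => ?_⟩
  · intro x hx i
    obtain ⟨w, -, rfl⟩ := Finset.mem_image.mp hx
    exact hB w i
  -- The colouring of words yields a colouring χ of vertices; a line over a χ-monochromatic edge b
  -- is monochromatic.
  · obtain ⟨χ, hχ⟩ := hpic.ramsey fun w =>
      if h : φ w ∈ X then c ⟨φ w, h⟩ else Classical.arbitrary (Fin r)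
    obtain ⟨b, j, hj⟩ := hn χ
    obtain ⟨L, ⟨x₀, hx₀⟩, hlab, hcol⟩ := hχ b
    refine ⟨(fun i => ∑ x, M x * (L x).elim 0 (fun p => p.1 i)) + fun _ => B,
      ∑ x, M x * (L x).elim 1 fun _ => 0, ?_, j, fun f hf => ?_⟩
    · refine Finset.sum_pos' (fun x _ => mul_nonneg (hM x).le ?_)
        ⟨x₀, Finset.mem_univ _, by simp [hx₀, hM]⟩
      cases L x <;> simp
    · have hpt : φ (linePoint L ⟨f, hf⟩) =
          ((fun i => ∑ x, M x * (L x).elim 0 (fun p => p.1 i)) + fun _ => B) +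
            (∑ x, M x * (L x).elim 1 fun _ => 0) • f := by
        simp only [φ, combination_linePoint]
        exact add_right_comm _ _ _
      have hmem := hX _ _ (hlab ⟨f, hf⟩)
      have h1 := hcol ⟨f, hf⟩ (Set.mem_univ _)
      rw [dif_pos hmem, hj] at h1
      rw [← hpt]
      exact ⟨hmem, h1⟩
  · have hword : ∀ y : Y, ∃ w u, φ w = y ∧ Lab w u := by
      rintro ⟨y, hy⟩
      obtain ⟨w, hw, rfl⟩ := Finset.mem_image.mp (hY hy)
      obtain ⟨u, hu⟩ := (Finset.mem_filter.mp hw).2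
      exact ⟨w, u, rfl, hu⟩
    choose W U hW hU using hword
    -- Words with equal images do no harm: a point is good if some word over it has its label
    -- outside T ω.
    obtain ⟨ω, Z, hZY, hZ, hcard⟩ := exists_large_member Y
      (fun ω y => ∃ w u, φ w = y ∧ Lab w u ∧ u ∉ T ω) μ fun y hy => by
        refine (hdens (U ⟨y, hy⟩)).trans ?_
        exact_mod_cast Nat.card_le_card_of_injective
          (fun ω : {ω // U ⟨y, hy⟩ ∉ T ω} => (⟨ω.1, W ⟨y, hy⟩, U ⟨y, hy⟩, hW _, hU _, ω.2⟩ :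
            {ω // ∃ w u, φ w = y ∧ Lab w u ∧ u ∉ T ω}))
          fun ω ω' h => Subtype.ext (Subtype.mk.inj h)
    refine ⟨Z, hZY, ?_, hcard⟩
    rintro ⟨t, ht, g, hg, hcong⟩
    choose w u hw hlab hu using fun f => hZ (g f) (hg f)
    have hq : IsQuasiLine w := hgen w t ht fun f f' => by
      rw [← hφ, hw, hw]
      exact hcong.sq_mul_normSq f f'
    obtain ⟨b, σ, hσ, hσu⟩ := hpic.faithful w hq u hlab
    obtain ⟨a, ha⟩ := hhit ω b
    obtain ⟨f, hf⟩ := Finite.surjective_of_injective hσ (F.equivFin.symm a)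
    apply hu f
    rw [hσu, hf, Equiv.apply_symm_apply]
    exact ha
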